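/- Fix $k$ customer types with arrival probabilities $\lambda_j>0$, $\sum_{j=1}^k\lambda_j=1$, revenues $0\le v_j<1$ and show-up probabilities $p_j\in(0,1]\cap\mathbb{Q}$ such that $v_j/p_j<1$ for all $j$ and $v_1/p_1\ge v_2/p_2\ge\cdots\ge v_k/p_k$, where $v_i/p_i=v_j/p_j$ with $i<j$ implies $v_i>v_j$ and $p_i>p_j$. For a horizon $T\in\mathbb{N}$ and a capacity $B\in\mathbb{N}$, let $\vec A=(A_1,\dots,A_T)$ and $\vec A'=(A'_1,\dots,A'_T)$ be independent vectors, each with i.i.d. coordinates that equal $j$ with probability $\lambda_j$. Let $N_j[t,T]$ be the number of $s\in\{t,\dots,T\}$ with $A_s=j$. For $\vec x\in\mathbb{N}^k$ let $V_B(\vec x)=\mathbb{E}\big[\big(\sum_j X_j-B\big)^+\big]$ with independent $X_j\sim\mathrm{Bin}(x_j,p_j)$. Given past acceptances $\vec y\in\mathbb{N}^k$ and (estimated) future arrivals $\vec N\in\mathbb{N}^k$, an index solution is an integer vector $\vec x$ with $0\le x_j\le N_j$ for all $j$ for which there is a threshold $\tilde\jmath\in\{1,\dots,k\}$ with $x_j=N_j$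 for $j<\tilde\jmath$ and $x_j=0$ for $j>\tilde\jmath$. It is optimal if it maximizes $\sum_j v_j(y_j+x_j)-V_B(\vec y+\vec x)$ among all index solutions. The online index policy starts with $\vec x[0]=0$. In period $t=1,\dots,T$, in which a customer of type $i=A_t$ arrives, it sets $\widetilde N_j[t]=|\{s\in\{t+1,\dots,T\}:A'_s=j\}|+\mathbf{1}_{\{j=i\}}$ for all $j$, takes an optimal index solution $\vec x'$ for past acceptances $\vec x[t-1]$ and future arrivals $\widetilde N[t]$, and accepts the customer (so that $\vec x[t]=\vec x[t-1]+e_i$) if $x'_i\ge\widetilde N_i[t]/2$, and otherwise rejects (so that $\vec x[t]=\vec x[t-1]$); ties between optimal index solutions are broken by an arbitrary deterministic rule, a function of $t$, $\vec x[t-1]$ and $\widetilde N[t]$. The hybrid clairvoyant index objective $\mathcal{H}_{\vec A}[t]$ is the objective value of an optimal index solution for past acceptances $\vec x[t-1]$ and future arrivals $N[t,T]$. Then there is a constant $M_2$, depending only on $k$ and on $(\lambda_j,v_j,p_j)_{j\le k}$ (and not on $T$, on $B$ or on the tie-breaking rule), such that $$\sum_{t=2}^T\mathbb{P}\big[\mathcal{H}_{\vec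 A}[t-1]-\mathcal{H}_{\vec A}[t]>0\big]\le M_2,$$ where the probability is over both $\vec A$ and $\vec A'$. -/

import Mathlib

noncomputable section

/-- The fixed customer parameters of single-resource revenue management with no-shows, for `k`
customer types (numbered from the best critical ratio to the worst). -/
structure CustomerTypes (k : ℕ) where
  /-- `lam j`: probability that an arrival is of type `j` -/
  lam : Fin k → ℝ
  /-- `v j`: revenue of an accepted customer of type `j` (the compensation is normalized to `1`) -/
  v : Fin k → ℝ
  /-- `p j`: probability that an accepted customer of type `j` shows up and needs a resource -/
  p : Fin k → unitInterval
  lam_pos : ∀ j, 0 < lam j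
  lam_sum : ∑ j, lam j = 1
  v_nonneg : ∀ j, 0 ≤ v j
  p_pos : ∀ j, 0 < (p j : ℝ)
  p_rat : ∀ j, ∃ r : ℚ, (p j : ℝ) = r
  /-- all critical ratios `v j / p j` are below `1` (so `v j < 1`) -/
  ratio_lt_one : ∀ j, v j / p j < 1
  /-- types are ordered by nonincreasing critical ratio -/
  ratio_antitone : ∀ i j, i < j → v j / p j ≤ v i / p i
  /-- ties are broken in favor of the greater value -/
  ratio_tie : ∀ i j, i < j → v i / p i = v j / p j → v j < v i ∧ (p j : ℝ) < p i

namespace CustomerTypes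

variable {k : ℕ} (I : CustomerTypes k)

/-- Distribution of the type of one arrival. -/
def typeDist : PMF (Fin k) :=
  PMF.ofFintype (fun j => ENNReal.ofReal (I.lam j)) (by
    rw [← ENNReal.ofReal_sum_of_nonneg (fun j _ => (I.lam_pos j).le), I.lam_sum,
      ENNReal.ofReal_one])

/-- Law of an i.i.d. arrival vector of length `T`; coordinate `u : Fin T` is period `u + 1`. -/
def arrivalLaw (T : ℕ) : MeasureTheory.Measure (Fin T → Fin k) :=
  MeasureTheory.Measure.pi (fun _ => I.typeDist.toMeasure)

/-- Joint law of the true arrival vector `A` and the independent, identically distributed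
sampled vector `A'`. -/
def jointLaw (T : ℕ) : MeasureTheory.Measure ((Fin T → Fin k) × (Fin T → Fin k)) :=
  (I.arrivalLaw T).prod (I.arrivalLaw T)

/-- Expected compensation `V_B(x) = 𝔼[(∑ j, X j - B)⁺]` with independent `X j ∼ Bin(x j, p j)`. -/
def compensation (B : ℕ) (x : Fin k → ℕ) : ℝ :=
  ∫ X : Fin k → ℕ, max ((∑ j, (X j : ℝ)) - (B : ℝ)) 0
    ∂ MeasureTheory.Measure.pi (fun j => ProbabilityTheory.binomial (x j) (I.p j))

/-- Objective value of accepting `x` future customers on top of `past` accepted ones. -/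
def objective (B : ℕ) (past x : Fin k → ℕ) : ℝ :=
  ∑ j, I.v j * ((past j : ℝ) + (x j : ℝ)) - I.compensation B (past + x)

end CustomerTypes

/-- `x` is an index solution for (estimated) future arrivals `N`: it is feasible, and for some
threshold index all future arrivals of smaller index and none of larger index are accepted. -/
def IsIndexSolution {k : ℕ} (N x : Fin k → ℕ) : Prop :=
  (∀ j, x j ≤ N j) ∧ ∃ th : Fin k, (∀ j, j < th → x j = N j) ∧ (∀ j, th < j → x j = 0)

/-- `N_j[s,T]`: number of type-`j` arrivals of `a` in periods `s, …, T`. -/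
def arrivalCount {k T : ℕ} (a : Fin T → Fin k) (s : ℕ) (j : Fin k) : ℕ :=
  (Finset.univ.filter (fun u : Fin T => s ≤ (u : ℕ) + 1 ∧ a u = j)).card

namespace CustomerTypes

variable {k : ℕ} (I : CustomerTypes k)

/-- `x` is an optimal index solution for past acceptances `past` and future arrivals `N`. -/
def IsOptimalIndexSolution (B : ℕ) (past N x : Fin k → ℕ) : Prop :=
  IsIndexSolution N x ∧ ∀ y, IsIndexSolution N y → I.objective B past y ≤ I.objective B past x

/-- The largest objective value of an index solution. -/
def indexValue (B : ℕ) (past N : Fin k → ℕ) : ℝ :=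
  sSup {r : ℝ | ∃ x, IsIndexSolution N x ∧ r = I.objective B past x}

/-- A rule that returns, in every period and for all inputs, some optimal index solution; ties
between optimal index solutions may be broken in any way. -/
def IsOptimalRule (B : ℕ) (rule : ℕ → (Fin k → ℕ) → (Fin k → ℕ) → (Fin k → ℕ)) : Prop :=
  ∀ t past N, I.IsOptimalIndexSolution B past N (rule t past N)

end CustomerTypes

/-- The online index policy: `accepted rule a a' t` is the vector `x[t]` of customers accepted in
periods `1, …, t`, for true arrivals `a` and sampled arrivals `a'`. In period `t + 1` with arriving
type `i` the estimate is the number of sampled arrivals in periods `t + 2, …, T` plus the current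
arrival, and `i` is accepted iff the optimal index solution for this estimate takes at least half
of the estimated type-`i` arrivals. -/
def accepted {k T : ℕ} (rule : ℕ → (Fin k → ℕ) → (Fin k → ℕ) → (Fin k → ℕ))
    (a a' : Fin T → Fin k) : ℕ → (Fin k → ℕ)
  | 0 => 0
  | t + 1 =>
    if h : t < T then
      let i : Fin k := a ⟨t, h⟩
      let est : Fin k → ℕ := fun j => arrivalCount a' (t + 2) j + if i = j then 1 else 0
      let x' : Fin k → ℕ := rule (t + 1) (accepted rule a a' t) est
      if (est i : ℝ) / 2 ≤ (x' i : ℝ) then accepted rule a a' t + Pi.single i 1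
      else accepted rule a a' t
    else accepted rule a a' t

/-- The hybrid clairvoyant index objective in period `t ≥ 1`: the best index solution for the exact
future arrivals of periods `t, …, T`, given the policy's acceptances in periods `1, …, t - 1`. -/
def hybrid {k T : ℕ} (I : CustomerTypes k) (B : ℕ)
    (rule : ℕ → (Fin k → ℕ) → (Fin k → ℕ) → (Fin k → ℕ)) (a a' : Fin T → Fin k) (t : ℕ) : ℝ :=
  I.indexValue B (accepted rule a a' (t - 1)) (arrivalCount a t)

namespace CustomerTypes

theorem exists_type {k : ℕ} (I : CustomerTypes k) : Nonempty (Fin k) := by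
  by_contra h
  have : IsEmpty (Fin k) := not_nonempty_iff.mp h
  have := I.lam_sum
  simp at this

theorem finite_indexSolutions {k : ℕ} (N : Fin k → ℕ) : {x | IsIndexSolution N x}.Finite :=
  (Set.finite_Iic N).subset (fun _ hx => hx.1)

/-- Optimal index solutions always exist. -/
theorem exists_optimalIndexSolution {k : ℕ} (I : CustomerTypes k) (B : ℕ) (past N : Fin k → ℕ) :
    ∃ x, I.IsOptimalIndexSolution B past N x := by
  obtain ⟨j0⟩ := I.exists_type
  have hk : 0 < k := j0.pos
  have hne : {x | IsIndexSolution N x}.Nonempty :=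
    ⟨0, fun j => Nat.zero_le _, ⟨0, hk⟩, fun j hj => absurd hj (by simp [Fin.lt_def]),
      fun j _ => rfl⟩
  obtain ⟨x, hx, hmax⟩ := Set.exists_max_image _ (I.objective B past) (finite_indexSolutions N) hne
  exact ⟨x, hx, hmax⟩

/-- The supremum in `indexValue` is attained exactly by the optimal index solutions. -/
theorem indexValue_eq {k : ℕ} (I : CustomerTypes k) {B : ℕ} {past N x : Fin k → ℕ} (hx : I.IsOptimalIndexSolution B past N x) :
    I.indexValue B past N = I.objective B past x := by
  refine IsGreatest.csSup_eq ⟨⟨x, hx.1, rfl⟩, ?_⟩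
  rintro r ⟨y, hy, rfl⟩
  exact hx.2 y hy

theorem exists_optimalRule {k : ℕ} (I : CustomerTypes k) (B : ℕ) : ∃ rule, I.IsOptimalRule B rule := by
  choose f hf using I.exists_optimalIndexSolution B
  exact ⟨fun _ past N => f past N, fun _ past N => hf past N⟩

end CustomerTypes

end

/-!
Write `r i = v i / p i` for the critical ratios and `F_x(b) = P(∑ j, X j < b)` for independent
`X j ∼ Bin(x j, p j)`. One more customer of type `i` on top of `x` changes the objective by
`v i - p i * (1 - F_x(B))` (`objective_add_single`), so it pays off exactly if `1 - r i ≤ F_x(B)`.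
Since `F_x(B)` decreases in `x` and the ratios are ordered, the number of customers of type `i` in
an optimal index solution is governed by `F` at a vector that contains all arrivals of better
types, some of type `i`, and none of the later types (`prefixVector`).

Suppose that the decision on an arrival of type `i` decreases the hybrid objective. If it was
accepted, then no maximal optimal index solution for the true arrivals `N` contains type `i`, so
`F` lies below `1 - r i` already at the prefix with no customer of type `i`, whereas the solution
for the sampled arrivals `N'` contains at least half of type `i` and `F` is at least `1 - r i`
there. If it was rejected, the roles of `N` and `N'` are interchanged. In either case two prefixes
compare in the wrong way: the one with a smaller value of `F` lacks a number `w` of customers of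
type `i`, linear in the number `n` of remaining periods, and exceeds the other one only by the
deviation `d` between `N` and `N'`, which is small against `n` unless one of the counts is far
from its mean.

This is impossible for `w ≥ C * d + w₀` (`exists_probBelow_comparison`), with constants that do
not depend on the past acceptances. Since those are unbounded in number, the two values of `F` can
be arbitrarily close; they are compared exactly, by means of the log-concavity of `b ↦ F_x(b)` and
a geometric majorant (`exists_iterate_bernoulliStep_le`). That `r i < 1` keeps the larger of the
two values away from zero.

By Hoeffding's inequality the counts are far from their means with a probability that is
exponentially small in `n` (`measureReal_arrivalCount_deviation_le`), and the sum over the periods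
is bounded by a geometric series.
-/

open MeasureTheory ProbabilityTheory

/-! ### The law of the number of customers that show up -/

/-- Conditioning on one of `n + 1` Bernoulli trials. -/
theorem integral_binomial_succ (n : ℕ) (p : unitInterval) (f : ℕ → ℝ) :
    ∫ m, f m ∂(binomial (n + 1) p)
      = (1 - p) * ∫ m, f m ∂(binomial n p) + p * ∫ m, f (m + 1) ∂(binomial n p) := by
  have key : ∀ n : ℕ, ∀ g : ℕ → ℝ, ∫ m, g m ∂(binomial n p) =
      ∑ m ∈ Finset.range (n + 1), (n.choose m * (p : ℝ) ^ m * (1 - p) ^ (n - m)) * g m := by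
    intro n g
    rw [integral_binomial]
    exact Finset.sum_congr (by ext; simp) fun _ _ => rfl
  rw [key, key, key, Finset.sum_range_succ']
  have h1 : (∑ m ∈ Finset.range (n + 1), (n.choose m * (p : ℝ) ^ m * (1 - p) ^ (n - m)) * f m)
      = (∑ m ∈ Finset.range (n + 1),
          (n.choose (m + 1) * (p : ℝ) ^ (m + 1) * (1 - p) ^ (n - (m + 1))) * f (m + 1))
        + (1 - (p : ℝ)) ^ n * f 0 := by
    rw [Finset.sum_range_succ', Finset.sum_range_succ _ n]
    simp
  rw [h1, mul_add, Finset.mul_sum, Finset.mul_sum, add_right_comm, ← Finset.sum_add_distrib]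
  congr 1
  · refine Finset.sum_congr rfl fun m hm => ?_
    have hm' : m ≤ n := Nat.lt_succ_iff.mp (Finset.mem_range.mp hm)
    rw [Nat.choose_succ_succ, Nat.succ_sub_succ]
    rcases hm'.eq_or_lt with rfl | hlt
    · simp [pow_succ]; ring
    · obtain ⟨s, rfl⟩ := Nat.exists_eq_add_of_lt hlt
      rw [show m + s + 1 - m = s + 1 by omega, show m + s + 1 - (m + 1) = s by omega]
      push_cast
      ring
  · simp [pow_succ]; ring

theorem ae_le_pi_binomial {ι : Type*} [Fintype ι] (x : ι → ℕ) (q : ι → unitInterval) :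
    ∀ᵐ X ∂ Measure.pi (fun j => binomial (x j) (q j)), ∀ j, X j ≤ x j := by
  refine ae_all_iff.mpr fun j => ?_
  have h : ∀ᵐ m ∂ binomial (x j) (q j), m ≤ x j := ae_le_of_hasLaw_binomial HasLaw.id
  exact (Measure.quasiMeasurePreserving_eval (fun j => binomial (x j) (q j)) j).ae h

theorem integrable_pi_binomial {ι : Type*} [Fintype ι] (x : ι → ℕ) (q : ι → unitInterval)
    (g : (ι → ℕ) → ℝ) : Integrable g (Measure.pi (fun j => binomial (x j) (q j))) := by
  classical
  obtain ⟨M, hM⟩ := ((Set.finite_Iic x).image fun X => ‖g X‖).bddAbove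
  refine Integrable.of_bound (C := M) (measurable_of_countable g).aestronglyMeasurable ?_
  filter_upwards [ae_le_pi_binomial x q] with X hX
  exact hM ⟨X, hX, rfl⟩

namespace CustomerTypes

variable {k : ℕ} (I : CustomerTypes k)

/-- `𝔼[φ(∑ j, X j)]` for independent `X j ∼ Bin(x j, p j)`. -/
noncomputable def showUpMean (x : Fin k → ℕ) (φ : ℕ → ℝ) : ℝ :=
  ∫ X : Fin k → ℕ, φ (∑ j, X j) ∂ Measure.pi (fun j => binomial (x j) (I.p j))

theorem showUpMean_zero (φ : ℕ → ℝ) : I.showUpMean 0 φ = φ 0 := by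
  have h : ∀ᵐ X ∂ Measure.pi (fun j : Fin k => binomial ((0 : Fin k → ℕ) j) (I.p j)),
      φ (∑ j, X j) = φ 0 := by
    filter_upwards [ae_le_pi_binomial (0 : Fin k → ℕ) I.p] with X hX
    rw [Finset.sum_eq_zero fun j _ => Nat.le_zero.mp (hX j)]
  rw [showUpMean, integral_congr_ae h]
  simp

/-- Conditioning on the show-up of one customer of type `j`. -/
theorem showUpMean_add_single (x : Fin k → ℕ) (j : Fin k) (φ : ℕ → ℝ) :
    I.showUpMean (x + Pi.single j 1) φ
      = (1 - I.p j) * I.showUpMean x φ + I.p j * I.showUpMean x (fun s => φ (s + 1)) := by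
  obtain ⟨n, rfl⟩ : ∃ n, k = n + 1 := ⟨k - 1, by have := j.pos; omega⟩
  have key : ∀ (z : Fin (n + 1) → ℕ) (ψ : ℕ → ℝ), I.showUpMean z ψ =
      ∫ Y, ∫ m, ψ (m + ∑ l, Y l) ∂(binomial (z j) (I.p j))
        ∂(Measure.pi fun l => binomial (z (j.succAbove l)) (I.p (j.succAbove l))) := by
    intro z ψ
    let μ : Fin (n + 1) → Measure ℕ := fun l => binomial (z l) (I.p l)
    have mp := measurePreserving_piFinSuccAbove μ j
    have hint := integrable_pi_binomial z I.p (fun X => ψ (∑ l, X l))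
    have hint' : Integrable (fun q : ℕ × (Fin n → ℕ) => ψ (q.1 + ∑ l, q.2 l))
        ((μ j).prod (Measure.pi fun l => μ (j.succAbove l))) := by
      rw [← mp.integrable_comp_emb (MeasurableEquiv.measurableEmbedding _)]
      refine hint.congr (Filter.Eventually.of_forall fun X => ?_)
      exact congrArg ψ (Fin.sum_univ_succAbove _ j)
    rw [← integral_prod_symm _ hint',
      ← mp.integral_comp (MeasurableEquiv.measurableEmbedding _)]
    refine integral_congr_ae (Filter.Eventually.of_forall fun X => ?_)
    exact congrArg ψ (Fin.sum_univ_succAbove _ j)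
  have hint := fun g => integrable_pi_binomial (fun l => x (j.succAbove l))
    (fun l => I.p (j.succAbove l)) g
  rw [key, key x, key x, ← integral_const_mul, ← integral_const_mul,
    ← integral_add (hint _) (hint _)]
  have h1 : (x + Pi.single j 1 : Fin (n + 1) → ℕ) j = x j + 1 := by simp
  have h2 : ∀ l, (x + Pi.single j 1 : Fin (n + 1) → ℕ) (j.succAbove l) = x (j.succAbove l) := by
    simp
  simp only [h2]
  refine integral_congr_ae (Filter.Eventually.of_forall fun Y => ?_)
  simp only [h1, integral_binomial_succ, add_right_comm]

theorem showUpMean_sub (x : Fin k → ℕ) (φ ψ : ℕ → ℝ) :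
    I.showUpMean x (fun s => φ s - ψ s) = I.showUpMean x φ - I.showUpMean x ψ :=
  integral_sub (integrable_pi_binomial x I.p _) (integrable_pi_binomial x I.p _)

theorem showUpMean_const (x : Fin k → ℕ) (c : ℝ) : I.showUpMean x (fun _ => c) = c := by
  simp [showUpMean]

theorem compensation_eq (B : ℕ) (x : Fin k → ℕ) :
    I.compensation B x = I.showUpMean x (fun s => max ((s : ℝ) - B) 0) := by
  simp [compensation, showUpMean]

/-- `P(∑ j, X j < b)` for independent `X j ∼ Bin(x j, p j)`. The bound `b` is an integer, so that
conditioning on the show-up of a customer is a shift of `b` by one, without a boundary case. -/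
noncomputable def probBelow (x : Fin k → ℕ) (b : ℤ) : ℝ :=
  I.showUpMean x (fun s => if (s : ℤ) < b then 1 else 0)

theorem probBelow_zero (b : ℤ) : I.probBelow 0 b = if 0 < b then 1 else 0 := by
  simp [probBelow, showUpMean_zero]

theorem probBelow_add_single (x : Fin k → ℕ) (j : Fin k) (b : ℤ) :
    I.probBelow (x + Pi.single j 1) b
      = (1 - I.p j) * I.probBelow x b + I.p j * I.probBelow x (b - 1) := by
  simp only [probBelow, showUpMean_add_single, Nat.cast_add, Nat.cast_one, lt_sub_iff_add_lt]

theorem probBelow_nonneg (x : Fin k → ℕ) (b : ℤ) : 0 ≤ I.probBelow x b :=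
  integral_nonneg fun X => by dsimp only; split_ifs <;> norm_num

theorem probBelow_mono (x : Fin k → ℕ) : Monotone (I.probBelow x) := by
  intro b c hbc
  refine integral_mono (integrable_pi_binomial x I.p _) (integrable_pi_binomial x I.p _) ?_
  intro X
  dsimp only
  split_ifs with h1 h2 <;> first | exact absurd (h1.trans_le hbc) h2 | norm_num

theorem probBelow_le_one (x : Fin k → ℕ) (b : ℤ) : I.probBelow x b ≤ 1 := by
  rw [← I.showUpMean_const x 1]
  refine integral_mono (integrable_pi_binomial x I.p _) (integrable_pi_binomial x I.p _) ?_
  intro X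
  dsimp only
  split_ifs <;> norm_num

/-- One more customer of type `j` costs a compensation exactly if she shows up and the other
customers already use up the capacity. -/
theorem compensation_add_single (B : ℕ) (x : Fin k → ℕ) (j : Fin k) :
    I.compensation B (x + Pi.single j 1)
      = I.compensation B x + I.p j * (1 - I.probBelow x B) := by
  have h : I.showUpMean x (fun s => max (((s + 1 : ℕ) : ℝ) - B) 0)
      - I.showUpMean x (fun s => max ((s : ℝ) - B) 0) = 1 - I.probBelow x B := by
    rw [← I.showUpMean_const x 1, probBelow, ← showUpMean_sub, ← showUpMean_sub]
    congr 1
    ext s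
    rcases lt_or_ge s B with hs | hs
    · have h1 : ((s : ℝ) + 1) ≤ B := by exact_mod_cast hs
      rw [if_pos (by exact_mod_cast hs), max_eq_right (by push_cast; linarith),
        max_eq_right (by linarith)]
      norm_num
    · have h1 : (B : ℝ) ≤ s := by exact_mod_cast hs
      rw [if_neg (by omega), max_eq_left (by push_cast; linarith),
        max_eq_left (by linarith)]
      push_cast
      ring
  rw [compensation_eq, compensation_eq, showUpMean_add_single]
  linear_combination (I.p j : ℝ) * h

theorem objective_add_single (B : ℕ) (past x : Fin k → ℕ) (j : Fin k) :
    I.objective B past (x + Pi.single j 1)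
      = I.objective B past x + (I.v j - I.p j * (1 - I.probBelow (past + x) B)) := by
  have h : ∑ l, I.v l * ((past l : ℝ) + ((x + Pi.single j 1 : Fin k → ℕ) l : ℝ))
      = ∑ l, I.v l * ((past l : ℝ) + (x l : ℝ)) + I.v j := by
    have h1 : ∀ l, I.v l * ((past l : ℝ) + ((x + Pi.single j 1 : Fin k → ℕ) l : ℝ))
        = I.v l * ((past l : ℝ) + (x l : ℝ)) + if l = j then I.v j else 0 := by
      intro l
      rcases eq_or_ne l j with rfl | hl
      · simp; ring
      · simp [hl]
    simp only [h1, Finset.sum_add_distrib, Finset.sum_ite_eq', Finset.mem_univ, if_true]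
  rw [objective, objective, h, ← add_assoc, compensation_add_single]
  ring

end CustomerTypes

/-! ### Log-concave functions and Bernoulli steps -/

/-- The expectation of `f (b - X)` for `X ∼ Bernoulli(p)`. -/
def bernoulliStep (p : ℝ) (f : ℤ → ℝ) (b : ℤ) : ℝ := (1 - p) * f b + p * f (b - 1)

/-- Log-concavity on `ℤ`, in the form of an inequality for `2 × 2` minors, which for a nonnegative
function also excludes internal zeros. -/
def IsLogConcave (f : ℤ → ℝ) : Prop := ∀ m n, m ≤ n → f m * f (n + 1) ≤ f (m + 1) * f n

theorem IsLogConcave.bernoulliStep {f : ℤ → ℝ} (hf : IsLogConcave f) {p : ℝ} (hp0 : 0 ≤ p)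
    (hp1 : p ≤ 1) : IsLogConcave (bernoulliStep p f) := by
  intro m n hmn
  rcases hmn.eq_or_lt with rfl | hlt
  · rw [mul_comm]
  have h1 := hf m n hmn
  have h2 := hf (m - 1) (n - 1) (by omega)
  have h3 := hf (m - 1) n (by omega)
  have h4 := hf m (n - 1) (by omega)
  simp only [sub_add_cancel] at h2 h3 h4
  simp only [_root_.bernoulliStep, add_sub_cancel_right]
  have hq : 0 ≤ 1 - p := by linarith
  nlinarith [mul_le_mul_of_nonneg_left h1 (mul_nonneg hq hq),
    mul_le_mul_of_nonneg_left h2 (mul_nonneg hp0 hp0),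
    mul_le_mul_of_nonneg_left (h3.trans h4) (mul_nonneg hp0 hq)]

/-- A log-concave function lies below the geometric function through two neighbouring values. -/
theorem IsLogConcave.le_zpow {f : ℤ → ℝ} (hf : IsLogConcave f) {a : ℤ} {ρ : ℝ} (hρ : 0 < ρ)
    (ha : 0 < f a) (hstep : f (a - 1) = ρ * f a) (s : ℤ) : f (a + s) ≤ f a * ρ⁻¹ ^ s := by
  have hup : ∀ n : ℕ, f (a + n) ≤ f a * ρ⁻¹ ^ n := by
    intro n
    induction n with
    | zero => simp
    | succ n ih =>
      have h := hf (a - 1) (a + n) (by omega)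
      rw [sub_add_cancel, hstep] at h
      have h1 : ρ * f (a + n + 1) ≤ f (a + n) := by
        refine le_of_mul_le_mul_left ?_ ha
        linarith
      have h2 : f (a + n + 1) ≤ ρ⁻¹ * f (a + n) := by
        rw [inv_mul_eq_div, le_div_iff₀ hρ]; linarith
      push_cast
      rw [← add_assoc, pow_succ]
      have := mul_le_mul_of_nonneg_left ih (inv_pos.mpr hρ).le
      linarith
  have hdown : ∀ n : ℕ, f (a - n) ≤ f a * ρ ^ n := by
    intro n
    induction n with
    | zero => simp
    | succ n ih =>
      have h := hf (a - n - 1) (a - 1) (by omega)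
      rw [sub_add_cancel, sub_add_cancel, hstep] at h
      have h1 : f (a - n - 1) ≤ ρ * f (a - n) := by
        refine le_of_mul_le_mul_left ?_ ha
        linarith
      push_cast
      rw [← sub_sub, pow_succ]
      have := mul_le_mul_of_nonneg_left ih hρ.le
      linarith
  obtain ⟨n, rfl | rfl⟩ := s.eq_nat_or_neg
  · simpa using hup n
  · simpa [← sub_eq_add_neg] using hdown n

/-- Geometric functions are eigenfunctions of `bernoulliStep`, and constants are fixed by it. -/
theorem iterate_bernoulliStep_le {f : ℤ → ℝ} {p A K μ : ℝ} (hp0 : 0 ≤ p) (hp1 : p ≤ 1)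
    (hμ : 0 < μ) (hf : ∀ b, f b ≤ A + K * μ ^ b) (w : ℕ) (b : ℤ) :
    (bernoulliStep p)^[w] f b ≤ A + K * (1 - p + p * μ⁻¹) ^ w * μ ^ b := by
  induction w generalizing b with
  | zero => simpa using hf b
  | succ w ih =>
    rw [Function.iterate_succ_apply', bernoulliStep]
    have h1 := mul_le_mul_of_nonneg_left (ih b) (sub_nonneg.mpr hp1)
    have h2 := mul_le_mul_of_nonneg_left (ih (b - 1)) hp0
    rw [zpow_sub_one₀ hμ.ne'] at h2
    refine (add_le_add h1 h2).trans (le_of_eq ?_)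
    rw [pow_succ]
    ring

/-- `C` Bernoulli trials discount by at least the factor `ρ` that a deterministic unit step costs,
uniformly in `ρ` bounded away from zero. -/
theorem one_sub_mul_pow_le {p ρ₀ ρ : ℝ} (hp0 : 0 < p) (hp1 : p ≤ 1) (hρ₀ : 0 < ρ₀) (hρ : ρ₀ ≤ ρ)
    (hρ1 : ρ ≤ 1) {C : ℕ} (hC : (p * ρ₀)⁻¹ ≤ C) : (1 - p + p * ρ) ^ C ≤ ρ := by
  have hρpos : 0 < ρ := hρ₀.trans_le hρ
  have hbase : 0 ≤ 1 - p + p * ρ := by nlinarith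
  have h1 : 1 - p + p * ρ ≤ Real.exp (-(p * (1 - ρ))) := by
    have := Real.add_one_le_exp (-(p * (1 - ρ))); linarith
  have h2 : (ρ⁻¹ - 1) ≤ C * (p * (1 - ρ)) := by
    have h3 : 1 ≤ C * (p * ρ₀) := by
      have := mul_le_mul_of_nonneg_right hC (mul_pos hp0 hρ₀).le
      rwa [inv_mul_cancel₀ (mul_pos hp0 hρ₀).ne'] at this
    have h4 : 1 ≤ C * (p * ρ) :=
      h3.trans (mul_le_mul_of_nonneg_left (mul_le_mul_of_nonneg_left hρ hp0.le) C.cast_nonneg)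
    have h5 : ρ⁻¹ - 1 = ρ⁻¹ * (1 - ρ) := by field_simp
    have h6 : ρ⁻¹ ≤ C * p := by
      rw [inv_le_iff_one_le_mul₀ hρpos]; linarith
    rw [h5, ← mul_assoc]
    exact mul_le_mul_of_nonneg_right h6 (by linarith)
  calc (1 - p + p * ρ) ^ C ≤ Real.exp (-(p * (1 - ρ))) ^ C := pow_le_pow_left₀ hbase h1 C
    _ = Real.exp (-(C * (p * (1 - ρ)))) := by rw [← Real.exp_nat_mul]; ring_nf
    _ ≤ Real.exp (-(ρ⁻¹ - 1)) := Real.exp_le_exp.mpr (by linarith)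
    _ ≤ ρ := by
      rw [Real.exp_neg]
      refine inv_le_of_inv_le₀ hρpos ?_
      have := Real.add_one_le_exp (ρ⁻¹ - 1); linarith

/-- Moving a monotone log-concave `f` by a `Bin(w, p)` random distance decreases it at least as
much as moving it by the fixed distance `d`, if `w` is large against `d` and the result is bounded
away from zero.

For the slope `ρ = f (b - d - 1) / f (b - d)` log-concavity gives
`f (b - n) ≤ f (b - d) ρ ^ (n - d)`, and the mean of the right-hand side is
`f (b - d) (1 - p + p ρ) ^ w ρ ^ (-d)`. This settles the case that `ρ` is bounded away from zero;
if it is not, then `f` is small left of `b - d`, and `Bin(w, p)` is unlikely to be at most `d`. -/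
theorem exists_iterate_bernoulliStep_le {p r : ℝ} (hp0 : 0 < p) (hp1 : p ≤ 1) (hr0 : 0 ≤ r)
    (hr1 : r < 1) : ∃ C w₀ : ℕ, ∀ f : ℤ → ℝ, IsLogConcave f → Monotone f → (∀ b, 0 ≤ f b) →
      (∀ b, f b ≤ 1) → ∀ (d w : ℕ) (b : ℤ), C * d + w₀ ≤ w →
        1 - r ≤ (bernoulliStep p)^[w] f b → (bernoulliStep p)^[w] f b ≤ f (b - d) := by
  set ρ₀ : ℝ := (1 - r) / 2 with hρ₀def
  have hρ₀ : 0 < ρ₀ := by rw [hρ₀def]; linarith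
  have hρ₀half : ρ₀ ≤ 1 / 2 := by rw [hρ₀def]; linarith
  obtain ⟨C, hC⟩ := exists_nat_ge (p * ρ₀)⁻¹
  obtain ⟨w₀, hw₀⟩ := exists_pow_lt_of_lt_one hρ₀ (show 1 - p + p * (1 / 2) < 1 by linarith)
  refine ⟨C, w₀, fun f hlc hmono hf0 hf1 d w b hw hlow => ?_⟩
  have hpow : ∀ ρ, ρ₀ ≤ ρ → ρ ≤ 1 → (1 - p + p * ρ) ^ (C * d) ≤ ρ ^ d := by
    intro ρ h1 h2
    rw [pow_mul]
    exact pow_le_pow_left₀ (pow_nonneg (by nlinarith) _) (one_sub_mul_pow_le hp0 hp1 hρ₀ h1 h2 hC) d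
  by_cases hsmall : f (b - d - 1) ≤ ρ₀
  · -- Here `f (b - n) ≤ ρ₀ + 2 ^ (d - n)`, whose mean is below `2 ρ₀ = 1 - r`.
    exfalso
    have hbound : ∀ c : ℤ, f c ≤ ρ₀ + (2 : ℝ) ^ (-(b - d)) * 2 ^ c := by
      intro c
      rw [← zpow_add₀ two_ne_zero]
      rcases le_or_gt c (b - d - 1) with hc | hc
      · have : (0 : ℝ) < 2 ^ (-(b - d) + c) := by positivity
        linarith [hmono hc]
      · have : (1 : ℝ) ≤ 2 ^ (-(b - d) + c) := one_le_zpow₀ one_le_two (by omega)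
        linarith [hf1 c]
    have h := iterate_bernoulliStep_le hp0.le hp1 two_pos hbound w b
    have hq0 : 0 ≤ 1 - p + p * (1 / 2) := by linarith
    have hq1 : 1 - p + p * (1 / 2) ≤ 1 := by linarith
    have h1 : (1 - p + p * (1 / 2)) ^ w ≤ (1 / 2) ^ d * (1 - p + p * (1 / 2)) ^ w₀ := by
      refine (pow_le_pow_of_le_one hq0 hq1 hw).trans ?_
      rw [pow_add]
      exact mul_le_mul_of_nonneg_right (hpow (1 / 2) hρ₀half (by norm_num)) (pow_nonneg hq0 _)
    have h2 : (2 : ℝ) ^ (-(b - d)) * 2 ^ b = 2 ^ d := by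
      rw [← zpow_add₀ two_ne_zero, show -(b - d) + b = (d : ℤ) by ring, zpow_natCast]
    have h3 : (2 : ℝ) ^ d * (1 / 2) ^ d = 1 := by rw [← mul_pow]; norm_num
    rw [mul_right_comm, h2, ← one_div] at h
    have h4 := mul_le_mul_of_nonneg_left h1 (pow_nonneg (zero_le_two (α := ℝ)) d)
    rw [← mul_assoc, h3, one_mul] at h4
    have : 1 - r = 2 * ρ₀ := by rw [hρ₀def]; ring
    linarith
  · rw [not_le] at hsmall
    have hle : f (b - d - 1) ≤ f (b - d) := hmono (by omega)
    have ha : 0 < f (b - d) := hρ₀.trans (hsmall.trans_le hle)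
    set ρ : ℝ := f (b - d - 1) / f (b - d) with hρdef
    have hρ1 : ρ ≤ 1 := div_le_one_of_le₀ hle ha.le
    have hρ : ρ₀ ≤ ρ := by
      rw [hρdef, le_div_iff₀ ha]
      nlinarith [hf1 (b - d)]
    have hρpos : 0 < ρ := hρ₀.trans_le hρ
    have hstep : f (b - d - 1) = ρ * f (b - d) := by rw [hρdef, div_mul_cancel₀ _ ha.ne']
    have hbound : ∀ c : ℤ, f c ≤ 0 + f (b - d) * ρ⁻¹ ^ (-(b - d)) * ρ⁻¹ ^ c := by
      intro c
      have h := hlc.le_zpow hρpos ha hstep (c - (b - d))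
      rw [add_sub_cancel] at h
      rw [zero_add, mul_assoc, ← zpow_add₀ (inv_pos.mpr hρpos).ne']
      rwa [show -(b - d) + c = c - (b - (d : ℤ)) by ring]
    have h := iterate_bernoulliStep_le hp0.le hp1 (inv_pos.mpr hρpos) hbound w b
    have h2 : ρ⁻¹ ^ (-(b - d)) * ρ⁻¹ ^ b = ρ⁻¹ ^ d := by
      rw [← zpow_add₀ (inv_pos.mpr hρpos).ne', show -(b - d) + b = (d : ℤ) by ring, zpow_natCast]
    have h3 : (1 - p + p * ρ) ^ w ≤ ρ ^ d :=
      (pow_le_pow_of_le_one (by nlinarith) (by nlinarith) (by omega : C * d ≤ w)).trans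
        (hpow ρ hρ hρ1)
    have h4 : ρ⁻¹ ^ d * ρ ^ d = 1 := by rw [← mul_pow, inv_mul_cancel₀ hρpos.ne', one_pow]
    rw [zero_add, mul_right_comm, mul_assoc (f (b - d)), h2, inv_inv] at h
    refine h.trans ?_
    calc f (b - d) * ρ⁻¹ ^ d * (1 - p + p * ρ) ^ w ≤ f (b - d) * ρ⁻¹ ^ d * ρ ^ d :=
          mul_le_mul_of_nonneg_left h3 (mul_nonneg ha.le (by positivity))
      _ = f (b - d) := by rw [mul_assoc, h4, mul_one]

/-! ### Comparing two vectors of acceptances -/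

theorem induction_add_single {ι : Type*} [Fintype ι] [DecidableEq ι] {P : (ι → ℕ) → Prop}
    (zero : P 0) (add_single : ∀ x j, P x → P (x + Pi.single j 1)) (x : ι → ℕ) : P x := by
  induction h : ∑ j, x j generalizing x with
  | zero =>
    have : x = 0 := funext fun j => by simpa using (Finset.sum_eq_zero_iff.mp h) j
    rwa [this]
  | succ n ih =>
    obtain ⟨j, hj⟩ : ∃ j, 1 ≤ x j := by
      by_contra! hc
      simp [Finset.sum_eq_zero fun j _ => Nat.lt_one_iff.mp (hc j)] at h
    have hle : Pi.single j 1 ≤ x := by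
      intro l
      rcases eq_or_ne l j with rfl | hl
      · simpa using hj
      · simp [hl]
    have hx : x - Pi.single j 1 + Pi.single j 1 = x := tsub_add_cancel_of_le hle
    rw [← hx]
    refine add_single _ _ (ih _ ?_)
    have h' := congrArg (fun z : ι → ℕ => ∑ l, z l) hx
    simp only [Pi.add_apply, Finset.sum_add_distrib, Finset.sum_pi_single', Finset.mem_univ,
      if_true, h] at h'
    simpa using h'

namespace CustomerTypes

variable {k : ℕ} (I : CustomerTypes k)

theorem isLogConcave_probBelow (x : Fin k → ℕ) : IsLogConcave (I.probBelow x) := by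
  induction x using induction_add_single with
  | zero =>
    intro m n hmn
    simp only [probBelow_zero]
    split_ifs <;> first | omega | norm_num
  | add_single x j ih =>
    have h : I.probBelow (x + Pi.single j 1) = bernoulliStep (I.p j) (I.probBelow x) :=
      funext fun b => I.probBelow_add_single x j b
    rw [h]
    exact ih.bernoulliStep (I.p j).2.1 (I.p j).2.2

theorem probBelow_add_le (x u : Fin k → ℕ) (b : ℤ) : I.probBelow (x + u) b ≤ I.probBelow x b := by
  induction u using induction_add_single with
  | zero => simp
  | add_single u j ih =>
    rw [← add_assoc, probBelow_add_single]
    have h := I.probBelow_mono (x + u) (sub_one_lt b).le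
    have := mul_le_mul_of_nonneg_left h (I.p j).2.1
    linarith

theorem probBelow_anti {x z : Fin k → ℕ} (h : x ≤ z) (b : ℤ) :
    I.probBelow z b ≤ I.probBelow x b := by
  rw [← add_tsub_cancel_of_le h]
  exact I.probBelow_add_le x _ b

/-- The customers `u` use at most `∑ j, u j` resources. -/
theorem probBelow_sub_le (x u : Fin k → ℕ) (b : ℤ) :
    I.probBelow x (b - ∑ j, u j) ≤ I.probBelow (x + u) b := by
  induction u using induction_add_single generalizing b with
  | zero => simp
  | add_single u j ih =>
    rw [← add_assoc, probBelow_add_single]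
    have hsum : (∑ l, ((u + Pi.single j 1 : Fin k → ℕ) l : ℤ)) = ∑ l, (u l : ℤ) + 1 := by
      simp [Finset.sum_add_distrib, Pi.single_apply]
    push_cast at ih ⊢
    rw [hsum, ← sub_sub]
    have h1 := ih (b - 1)
    rw [sub_right_comm] at h1
    have h2 := I.probBelow_mono (x + u) (sub_one_lt b).le
    have := mul_le_mul_of_nonneg_left h2 (sub_nonneg.mpr (I.p j).2.2)
    linarith

theorem probBelow_add_single_nat (x : Fin k → ℕ) (j : Fin k) (w : ℕ) :
    I.probBelow (x + Pi.single j w) = (bernoulliStep (I.p j))^[w] (I.probBelow x) := by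
  induction w with
  | zero => simp
  | succ w ih =>
    rw [Function.iterate_succ_apply', ← ih, Pi.single_add, ← add_assoc]
    exact funext fun b => I.probBelow_add_single _ j b

theorem ratio_nonneg (j : Fin k) : 0 ≤ I.v j / I.p j := div_nonneg (I.v_nonneg j) (I.p_pos j).le

theorem ratio_anti {i j : Fin k} (h : i ≤ j) : I.v j / I.p j ≤ I.v i / I.p i := by
  rcases h.eq_or_lt with rfl | h
  · exact le_rfl
  · exact I.ratio_antitone i j h

/-- Sufficiently many customers of type `i` outweigh `d` customers of other types, unless the
capacity is exceeded with more than the critical probability of type `i`. -/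
theorem exists_probBelow_comparison : ∃ C w₀ : ℕ, ∀ (i : Fin k) (c z₁ z₂ : Fin k → ℕ) (d w : ℕ)
    (b : ℤ), C * d + w₀ ≤ w → c + Pi.single i w ≤ z₂ → ∑ j, (z₁ j - c j) ≤ d →
      1 - I.v i / I.p i ≤ I.probBelow z₂ b → I.probBelow z₂ b ≤ I.probBelow z₁ b := by
  have hex : ∀ i : Fin k, ∃ C w₀ : ℕ, ∀ (x : Fin k → ℕ) (d w : ℕ) (b : ℤ), C * d + w₀ ≤ w →
      1 - I.v i / I.p i ≤ I.probBelow (x + Pi.single i w) b →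
        I.probBelow (x + Pi.single i w) b ≤ I.probBelow x (b - d) := by
    intro i
    obtain ⟨C, w₀, h⟩ := exists_iterate_bernoulliStep_le (I.p_pos i) (I.p i).2.2
      (I.ratio_nonneg i) (I.ratio_lt_one i)
    refine ⟨C, w₀, fun x d w b hw => ?_⟩
    rw [probBelow_add_single_nat]
    exact h _ (I.isLogConcave_probBelow x) (I.probBelow_mono x) (I.probBelow_nonneg x)
      (I.probBelow_le_one x) d w b hw
  choose C w₀ h using hex
  refine ⟨∑ i, C i, ∑ i, w₀ i, fun i c z₁ z₂ d w b hw hz₂ hz₁ hlow => ?_⟩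
  have hC : C i ≤ ∑ i, C i := Finset.single_le_sum (fun _ _ => Nat.zero_le _) (Finset.mem_univ i)
  have hw₀ : w₀ i ≤ ∑ i, w₀ i := Finset.single_le_sum (fun _ _ => Nat.zero_le _) (Finset.mem_univ i)
  have hw' : C i * d + w₀ i ≤ w := (add_le_add (Nat.mul_le_mul_right d hC) hw₀).trans hw
  have h2 := I.probBelow_anti hz₂ b
  have hd : b - (d : ℤ) ≤ b - (∑ j, (z₁ - c) j : ℕ) :=
    sub_le_sub_left (Int.ofNat_le.mpr hz₁) b
  have h3 := I.probBelow_sub_le c (z₁ - c) b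
  have h4 : I.probBelow (c + (z₁ - c)) b ≤ I.probBelow z₁ b := I.probBelow_anti le_add_tsub b
  have h5 := h i c d w b hw' (hlow.trans h2)
  exact h2.trans (h5.trans ((I.probBelow_mono c hd).trans (h3.trans h4)))

end CustomerTypes

/-! ### Optimal index solutions and critical ratios -/

/-- All arrivals `N` of types before `i`, `m` customers of type `i`, and none of the later types. -/
def prefixVector {k : ℕ} (N : Fin k → ℕ) (i : Fin k) (m : ℕ) : Fin k → ℕ :=
  fun l => if l < i then N l else if l = i then m else 0

theorem prefixVector_add_single {k : ℕ} (N : Fin k → ℕ) (i : Fin k) (m : ℕ) :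
    prefixVector (N + Pi.single i 1) i m = prefixVector N i m := by
  ext l
  simp only [prefixVector]
  split_ifs with h
  · simp [h.ne]
  all_goals rfl

/-- Of an index solution that contains a customer of type `i`, a customer of the last accepted type
can be removed. -/
theorem IsIndexSolution.exists_eq_add_single {k : ℕ} {N x : Fin k → ℕ} (hx : IsIndexSolution N x)
    {i : Fin k} (hi : 1 ≤ x i) : ∃ j z, i ≤ j ∧ x = z + Pi.single j 1 ∧ IsIndexSolution N z ∧
      prefixVector N i (x i - 1) ≤ z := by
  obtain ⟨hle, th, hlt, hgt⟩ := hx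
  obtain ⟨j, hj, hmax⟩ := (Finset.univ.filter fun j => 1 ≤ x j).exists_max_image id
    ⟨i, by simpa using hi⟩
  simp only [Finset.mem_filter, Finset.mem_univ, true_and, id] at hj hmax
  have hij : i ≤ j := hmax i hi
  have hjth : j ≤ th := by
    by_contra! h
    rw [hgt j h] at hj
    omega
  have hz : x - Pi.single j 1 + Pi.single j 1 = x := by
    refine tsub_add_cancel_of_le fun l => ?_
    rcases eq_or_ne l j with rfl | hl
    · simpa using hj
    · simp [hl]
  have hzne : ∀ l, l ≠ j → (x - Pi.single j 1 : Fin k → ℕ) l = x l := fun l hl => by simp [hl]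
  have hzj : (x - Pi.single j 1 : Fin k → ℕ) j = x j - 1 := by simp
  refine ⟨j, x - Pi.single j 1, hij, hz.symm, ⟨fun l => (Nat.sub_le _ _).trans (hle l), j,
    fun l hl => ?_, fun l hl => ?_⟩, fun l => ?_⟩
  · rw [hzne l hl.ne, hlt l (hl.trans_le hjth)]
  · rw [hzne l hl.ne']
    by_contra hne
    exact absurd (hmax l (by omega)) (not_le.mpr hl)
  · simp only [prefixVector]
    split_ifs with h1 h2
    · rw [hzne l (h1.trans_le hij).ne, hlt l (h1.trans_le (hij.trans hjth))]
    · subst h2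
      rcases eq_or_ne l j with rfl | hl
      · rw [hzj]
      · rw [hzne l hl]
        omega
    · exact Nat.zero_le _

/-- To an index solution that rejects a customer of type `i`, a customer of the first not fully
accepted type can be added. -/
theorem IsIndexSolution.exists_add_single {k : ℕ} {N x : Fin k → ℕ} (hx : IsIndexSolution N x)
    {i : Fin k} (hi : x i < N i) : ∃ j ≤ i, IsIndexSolution N (x + Pi.single j 1) ∧
      x ≤ prefixVector N i (x i) := by
  obtain ⟨hle, th, hlt, hgt⟩ := hx
  obtain ⟨j, hj, hmin⟩ := (Finset.univ.filter fun j => x j < N j).exists_min_image id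
    ⟨i, by simpa using hi⟩
  simp only [Finset.mem_filter, Finset.mem_univ, true_and, id] at hj hmin
  have hji : j ≤ i := hmin i hi
  have hthj : th ≤ j := by
    by_contra! h
    exact absurd (hlt j h) hj.ne
  have hne : ∀ l, l ≠ j → (x + Pi.single j 1 : Fin k → ℕ) l = x l := fun l hl => by simp [hl]
  have hself : (x + Pi.single j 1 : Fin k → ℕ) j = x j + 1 := by simp
  refine ⟨j, hji, ⟨fun l => ?_, j, fun l hl => ?_, fun l hl => ?_⟩, fun l => ?_⟩
  · rcases eq_or_ne l j with rfl | hl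
    · rw [hself]; exact hj
    · rw [hne l hl]; exact hle l
  · rw [hne l hl.ne]
    by_contra hc
    exact absurd (hmin l (lt_of_le_of_ne (hle l) hc)) (not_le.mpr hl)
  · rw [hne l hl.ne', hgt l (hthj.trans_lt hl)]
  · simp only [prefixVector]
    split_ifs with h1 h2
    · exact hle l
    · rw [h2]
    · have : i < l := lt_of_le_of_ne (not_lt.mp h1) (Ne.symm h2)
      rw [hgt l (hthj.trans_lt (hji.trans_lt this))]

theorem IsIndexSolution.of_add_single {k : ℕ} {N z : Fin k → ℕ} {i : Fin k}
    (h : IsIndexSolution (N + Pi.single i 1) (z + Pi.single i 1)) : IsIndexSolution N z := by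
  obtain ⟨hle, th, hlt, hgt⟩ := h
  refine ⟨fun l => by simpa using hle l, th, fun l hl => by simpa using hlt l hl, fun l hl => ?_⟩
  have := hgt l hl
  rw [Pi.add_apply] at this
  omega

theorem IsIndexSolution.of_le {k : ℕ} {N x : Fin k → ℕ} {i : Fin k}
    (h : IsIndexSolution (N + Pi.single i 1) x) (hi : x i ≤ N i) : IsIndexSolution N x := by
  obtain ⟨hle, th, hlt, hgt⟩ := h
  refine ⟨fun l => ?_, th, fun l hl => ?_, hgt⟩
  · rcases eq_or_ne l i with rfl | hl
    · exact hi
    · simpa [hl] using hle l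
  · rcases eq_or_ne l i with rfl | hne
    · have := hlt l hl
      simp at this
      omega
    · simpa [hne] using hlt l hl

namespace CustomerTypes

variable {k : ℕ} (I : CustomerTypes k)

theorem objective_le_add_single_iff (B : ℕ) (past x : Fin k → ℕ) (j : Fin k) :
    I.objective B past x ≤ I.objective B past (x + Pi.single j 1)
      ↔ 1 - I.v j / I.p j ≤ I.probBelow (past + x) B := by
  rw [objective_add_single, le_add_iff_nonneg_right, sub_nonneg, sub_le_comm,
    le_div_iff₀ (I.p_pos j), mul_comm]

theorem objective_add_single_le_iff (B : ℕ) (past x : Fin k → ℕ) (j : Fin k) :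
    I.objective B past (x + Pi.single j 1) ≤ I.objective B past x
      ↔ I.probBelow (past + x) B ≤ 1 - I.v j / I.p j := by
  rw [objective_add_single, add_le_iff_nonpos_right, sub_nonpos, le_sub_comm,
    div_le_iff₀ (I.p_pos j), mul_comm]

theorem objective_past_add (B : ℕ) (past x u : Fin k → ℕ) :
    I.objective B (past + u) x = I.objective B past (x + u) := by
  simp only [objective, Pi.add_apply, Nat.cast_add]
  rw [add_assoc, add_comm u x]
  congr 1
  exact Finset.sum_congr rfl fun j _ => by ring

theorem objective_le_indexValue (B : ℕ) {past N x : Fin k → ℕ} (hx : IsIndexSolution N x) :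
    I.objective B past x ≤ I.indexValue B past N := by
  obtain ⟨z, hz⟩ := I.exists_optimalIndexSolution B past N
  rw [I.indexValue_eq hz]
  exact hz.2 x hx

variable {I}

/-- If an optimal index solution contains customers of type `i`, then the last one of them was worth
accepting. -/
theorem IsOptimalIndexSolution.le_probBelow {B : ℕ} {past N x : Fin k → ℕ}
    (hx : I.IsOptimalIndexSolution B past N x) {i : Fin k} (hi : 1 ≤ x i) :
    1 - I.v i / I.p i ≤ I.probBelow (past + prefixVector N i (x i - 1)) B := by
  obtain ⟨j, z, hij, hxz, hz, hle⟩ := hx.1.exists_eq_add_single hi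
  have h := hx.2 z hz
  rw [hxz, objective_le_add_single_iff] at h
  have h1 := I.ratio_anti hij
  have h2 := I.probBelow_anti (add_le_add_right hle past) B
  linarith

/-- If an optimal index solution does not contain all customers of type `i`, then another one of
them is not worth accepting. -/
theorem IsOptimalIndexSolution.probBelow_le {B : ℕ} {past N x : Fin k → ℕ}
    (hx : I.IsOptimalIndexSolution B past N x) {i : Fin k} (hi : x i < N i) :
    I.probBelow (past + prefixVector N i (x i)) B ≤ 1 - I.v i / I.p i := by
  obtain ⟨j, hji, hz, hle⟩ := hx.1.exists_add_single hi
  have h := hx.2 _ hz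
  rw [objective_add_single_le_iff] at h
  have h1 := I.ratio_anti hji
  have h2 := I.probBelow_anti (add_le_add_right hle past) B
  linarith

theorem finite_optimalIndexSolutions (B : ℕ) (past N : Fin k → ℕ) :
    {x | I.IsOptimalIndexSolution B past N x}.Finite :=
  (finite_indexSolutions N).subset fun _ hx => hx.1

/-- If accepting an arrival of type `i` decreases the index value, then already after the acceptance
of all customers of better types the next customer of type `i` is not worth accepting. -/
theorem probBelow_lt_of_indexValue_lt {B : ℕ} {past N : Fin k → ℕ} {i : Fin k}
    (h : I.indexValue B (past + Pi.single i 1) N < I.indexValue B past (N + Pi.single i 1)) :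
    I.probBelow (past + prefixVector N i 0) B < 1 - I.v i / I.p i := by
  -- Among the optimal solutions one with the most customers makes the inequality strict.
  obtain ⟨x, hx, hmax⟩ := Set.exists_max_image _ (fun x : Fin k → ℕ => ∑ l, x l)
    (finite_optimalIndexSolutions (I := I) B past (N + Pi.single i 1))
    (I.exists_optimalIndexSolution B past _)
  have hxi : x i = 0 := by
    by_contra hne
    have hz : x - Pi.single i 1 + Pi.single i 1 = x := by
      refine tsub_add_cancel_of_le fun l => ?_
      rcases eq_or_ne l i with rfl | hl
      · simp; omega
      · simp [hl]
    have h1 : IsIndexSolution N (x - Pi.single i 1) := by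
      apply IsIndexSolution.of_add_single (i := i)
      rw [hz]
      exact hx.1
    have h2 := I.objective_le_indexValue B (past := past + Pi.single i 1) h1
    rw [objective_past_add, hz, ← I.indexValue_eq hx] at h2
    exact absurd h (not_lt.mpr h2)
  obtain ⟨j, hji, hz, hle⟩ := hx.1.exists_add_single (i := i) (by simp [hxi])
  rw [prefixVector_add_single, hxi] at hle
  have h1 : I.probBelow (past + x) B < 1 - I.v j / I.p j := by
    by_contra! hc
    rw [← objective_le_add_single_iff] at hc
    have h2 := hmax (x + Pi.single j 1) ⟨hz, fun y hy => (hx.2 y hy).trans hc⟩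
    simp [Finset.sum_add_distrib] at h2
  have h2 := I.ratio_anti hji
  have h3 := I.probBelow_anti (add_le_add_right hle past) B
  linarith

/-- If rejecting an arrival of type `i` decreases the index value, then even after the acceptance of
all future customers of type `i` and of better types another one of type `i` is worth accepting. -/
theorem lt_probBelow_of_indexValue_lt {B : ℕ} {past N : Fin k → ℕ} {i : Fin k}
    (h : I.indexValue B past N < I.indexValue B past (N + Pi.single i 1)) :
    1 - I.v i / I.p i < I.probBelow (past + prefixVector N i (N i)) B := by
  -- Among the optimal solutions one with the fewest customers makes the inequality strict.
  obtain ⟨x, hx, hmin⟩ := Set.exists_min_image _ (fun x : Fin k → ℕ => ∑ l, x l)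
    (finite_optimalIndexSolutions (I := I) B past (N + Pi.single i 1))
    (I.exists_optimalIndexSolution B past _)
  have hxi : x i = N i + 1 := by
    refine le_antisymm (by simpa using hx.1.1 i) ?_
    by_contra! hc
    have h1 := I.objective_le_indexValue B (past := past) (hx.1.of_le (Nat.lt_succ_iff.mp hc))
    rw [← I.indexValue_eq hx] at h1
    exact absurd h (not_lt.mpr h1)
  obtain ⟨j, z, hij, hxz, hz, hle⟩ := hx.1.exists_eq_add_single (i := i) (by omega)
  rw [prefixVector_add_single, hxi, Nat.add_sub_cancel] at hle
  have h1 : 1 - I.v j / I.p j < I.probBelow (past + z) B := by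
    by_contra! hc
    rw [← objective_add_single_le_iff, ← hxz] at hc
    have h2 := hmin z ⟨hz, fun y hy => (hx.2 y hy).trans hc⟩
    simp [hxz, Finset.sum_add_distrib] at h2
  have h2 := I.ratio_anti hij
  have h3 := I.probBelow_anti (add_le_add_right hle past) B
  linarith

variable (I)

/-- One decision of the policy for an arrival of type `i` does not decrease the index value, if the
numbers `N` of future arrivals and `N'` of sampled future arrivals are large and close enough. -/
theorem exists_indexValue_le : ∃ C w₀ : ℕ, ∀ (B d : ℕ) (past N N' x : Fin k → ℕ) (i : Fin k),
    ∑ j, (N j - N' j) ≤ d → ∑ j, (N' j - N j) ≤ d →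
    2 * (C * d + w₀) ≤ N' i → 2 * (C * d + w₀) + N' i ≤ 2 * N i →
    I.IsOptimalIndexSolution B past (N' + Pi.single i 1) x →
    (N' i + 1 ≤ 2 * x i →
      I.indexValue B past (N + Pi.single i 1) ≤ I.indexValue B (past + Pi.single i 1) N) ∧
    (2 * x i < N' i + 1 →
      I.indexValue B past (N + Pi.single i 1) ≤ I.indexValue B past N) := by
  obtain ⟨C, w₀, hcomp⟩ := I.exists_probBelow_comparison
  refine ⟨C, w₀ + 1, fun B d past N N' x i hNN' hN'N hN' hN hx => ⟨fun hacc => ?_, fun hrej => ?_⟩⟩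
  · by_contra! hlt
    have h1 := probBelow_lt_of_indexValue_lt hlt
    have h2 := hx.le_probBelow (i := i) (by omega)
    rw [prefixVector_add_single] at h2
    have h3 := hcomp i (past + prefixVector (fun l => min (N l) (N' l)) i 0)
      (past + prefixVector N i 0) (past + prefixVector N' i (x i - 1)) d (x i - 1) B (by omega)
      (fun l => ?_) ((Finset.sum_le_sum fun l _ => ?_).trans hNN') h2
    · linarith
    · rcases eq_or_ne l i with rfl | hl
      · simp [prefixVector]
      · simp only [prefixVector, Pi.add_apply, Pi.single_apply, if_neg hl]
        split_ifs <;> omega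
    · simp only [prefixVector, Pi.add_apply]
      split_ifs <;> omega
  · by_contra! hlt
    have h1 := lt_probBelow_of_indexValue_lt hlt
    have h2 := hx.probBelow_le (i := i) (by simp; omega)
    rw [prefixVector_add_single] at h2
    have h3 := hcomp i (past + prefixVector (fun l => min (N l) (N' l)) i (x i))
      (past + prefixVector N' i (x i)) (past + prefixVector N i (N i)) d (N i - x i) B (by omega)
      (fun l => ?_) ((Finset.sum_le_sum fun l _ => ?_).trans hN'N) h1.le
    · linarith
    · rcases eq_or_ne l i with rfl | hl
      · simp [prefixVector]
        omega
      · simp only [prefixVector, Pi.add_apply, Pi.single_apply, if_neg hl]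
        split_ifs <;> omega
    · simp only [prefixVector, Pi.add_apply]
      split_ifs <;> omega

end CustomerTypes

/-! ### One period of the policy -/

theorem arrivalCount_succ {k T : ℕ} (a : Fin T → Fin k) {s : ℕ} (hs : s < T) :
    arrivalCount a (s + 1) = arrivalCount a (s + 2) + Pi.single (a ⟨s, hs⟩) 1 := by
  ext j
  have h : ∀ u : Fin T, (s + 1 ≤ (u : ℕ) + 1 ∧ a u = j) ↔
      (s + 2 ≤ (u : ℕ) + 1 ∧ a u = j) ∨ (u = ⟨s, hs⟩ ∧ a ⟨s, hs⟩ = j) := by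
    intro u
    rcases eq_or_ne u ⟨s, hs⟩ with rfl | hu
    · simp
    · have : (u : ℕ) ≠ s := fun h => hu (Fin.ext h)
      simp only [hu, false_and, or_false, and_congr_left_iff]
      intro _
      omega
  have hdisj : Disjoint (Finset.univ.filter fun u : Fin T => s + 2 ≤ (u : ℕ) + 1 ∧ a u = j)
      (Finset.univ.filter fun u : Fin T => u = ⟨s, hs⟩ ∧ a ⟨s, hs⟩ = j) := by
    refine Finset.disjoint_filter.mpr fun u _ h1 h2 => ?_
    rw [h2.1] at h1
    simp at h1
  simp only [arrivalCount, Pi.add_apply, h, Finset.filter_or, Finset.card_union_of_disjoint hdisj]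
  congr 1
  rcases eq_or_ne j (a ⟨s, hs⟩) with rfl | hj
  · simp [Finset.filter_eq']
  · simp [hj, hj.symm]

theorem accepted_succ {k T : ℕ} (rule : ℕ → (Fin k → ℕ) → (Fin k → ℕ) → (Fin k → ℕ))
    (a a' : Fin T → Fin k) {s : ℕ} (hs : s < T) :
    accepted rule a a' (s + 1) =
      if arrivalCount a' (s + 2) (a ⟨s, hs⟩) + 1 ≤ 2 * rule (s + 1) (accepted rule a a' s)
          (arrivalCount a' (s + 2) + Pi.single (a ⟨s, hs⟩) 1) (a ⟨s, hs⟩)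
      then accepted rule a a' s + Pi.single (a ⟨s, hs⟩) 1 else accepted rule a a' s := by
  have hest : (fun j => arrivalCount a' (s + 2) j + if a ⟨s, hs⟩ = j then 1 else 0)
      = arrivalCount a' (s + 2) + Pi.single (a ⟨s, hs⟩) 1 := by
    ext j
    simp [Pi.single_apply, eq_comm]
  have hdiv : ∀ m n : ℕ, (m : ℝ) / 2 ≤ n ↔ m ≤ 2 * n := by
    intro m n
    rw [div_le_iff₀ two_pos, mul_comm]
    exact_mod_cast Iff.rfl
  rw [accepted, dif_pos hs, ← hest]
  simp only [hdiv, if_true]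

namespace CustomerTypes

variable {k : ℕ} (I : CustomerTypes k)

/-- `exists_indexValue_le` for the decision of the policy in period `s + 1`. -/
theorem exists_hybrid_le : ∃ C w₀ : ℕ, ∀ (T B s d : ℕ)
    (rule : ℕ → (Fin k → ℕ) → (Fin k → ℕ) → (Fin k → ℕ)) (a a' : Fin T → Fin k),
    I.IsOptimalRule B rule → s < T →
    ∑ j, (arrivalCount a (s + 2) j - arrivalCount a' (s + 2) j) ≤ d →
    ∑ j, (arrivalCount a' (s + 2) j - arrivalCount a (s + 2) j) ≤ d →
    (∀ i, 2 * (C * d + w₀) ≤ arrivalCount a' (s + 2) i) →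
    (∀ i, 2 * (C * d + w₀) + arrivalCount a' (s + 2) i ≤ 2 * arrivalCount a (s + 2) i) →
    hybrid I B rule a a' (s + 1) ≤ hybrid I B rule a a' (s + 2) := by
  obtain ⟨C, w₀, h⟩ := I.exists_indexValue_le
  refine ⟨C, w₀, fun T B s d rule a a' hrule hs h1 h2 h3 h4 => ?_⟩
  set i := a ⟨s, hs⟩ with hi
  obtain ⟨hacc, hrej⟩ := h B d (accepted rule a a' s) _ _ _ i h1 h2 (h3 i) (h4 i)
    (hrule (s + 1) (accepted rule a a' s) (arrivalCount a' (s + 2) + Pi.single i 1))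
  rw [hybrid, hybrid, Nat.add_sub_cancel, show s + 2 - 1 = s + 1 by omega,
    arrivalCount_succ a hs, accepted_succ rule a a' hs, ← hi]
  split_ifs with hcond
  · exact hacc hcond
  · exact hrej (not_le.mp hcond)

/-! ### Concentration of the arrival counts -/

instance (T : ℕ) : IsProbabilityMeasure (I.arrivalLaw T) := by
  unfold arrivalLaw; infer_instance

instance (T : ℕ) : IsProbabilityMeasure (I.jointLaw T) := by
  unfold jointLaw; infer_instance

theorem integral_typeDist_indicator (j : Fin k) :
    ∫ i, (if i = j then (1 : ℝ) else 0) ∂I.typeDist.toMeasure = I.lam j := by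
  rw [PMF.integral_eq_sum]
  simp [typeDist, PMF.ofFintype_apply, (I.lam_pos j).le]

theorem hasSubgaussianMGF_arrival (T : ℕ) (j : Fin k) (u : Fin T) :
    HasSubgaussianMGF (fun a : Fin T → Fin k => (if a u = j then (1 : ℝ) else 0) - I.lam j)
      (1 / 4) (I.arrivalLaw T) := by
  have hmp : MeasurePreserving (Function.eval u) (I.arrivalLaw T) I.typeDist.toMeasure :=
    measurePreserving_eval _ u
  have hmean : ∫ a, (if a u = j then (1 : ℝ) else 0) ∂I.arrivalLaw T = I.lam j := by
    rw [← I.integral_typeDist_indicator j, ← hmp.map_eq,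
      integral_map hmp.measurable.aemeasurable
        (measurable_of_countable _).aestronglyMeasurable]
  have h := hasSubgaussianMGF_of_mem_Icc (μ := I.arrivalLaw T) (a := 0) (b := 1)
    (X := fun a : Fin T → Fin k => if a u = j then (1 : ℝ) else 0)
    (measurable_of_countable _).aemeasurable
    (Filter.Eventually.of_forall fun a => by split_ifs <;> simp)
  rw [hmean] at h
  convert h using 1
  rw [sub_zero, nnnorm_one, div_pow, one_pow]
  norm_num

/-- Hoeffding's inequality for the number of arrivals of type `j` in periods `t, …, T`. -/
theorem measureReal_arrivalCount_deviation_le {T t : ℕ} (ht : 1 ≤ t) (htT : t ≤ T) (j : Fin k)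
    {ε : ℝ} (hε : 0 < ε) :
    (I.arrivalLaw T).real {a | ε * (T + 1 - t : ℕ) ≤
        |(arrivalCount a t j : ℝ) - I.lam j * (T + 1 - t : ℕ)|}
      ≤ 2 * Real.exp (-(2 * ε ^ 2)) ^ (T + 1 - t) := by
  set n := T + 1 - t with hn
  have hnpos : (0 : ℝ) < n := by
    have : 0 < n := by omega
    exact_mod_cast this
  set S : Finset (Fin T) := Finset.univ.filter fun u => t ≤ (u : ℕ) + 1 with hS
  have hcard : S.card = n := by
    have h1 : S.map Fin.valEmbedding = Finset.Ico (t - 1) T := by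
      ext m
      simp only [hS, Finset.mem_map, Finset.mem_filter, Finset.mem_univ, true_and,
        Fin.valEmbedding_apply, Finset.mem_Ico]
      constructor
      · rintro ⟨u, hu, rfl⟩
        have := u.2
        omega
      · rintro ⟨h1, h2⟩
        exact ⟨⟨m, h2⟩, by simp only; omega, rfl⟩
    rw [← Finset.card_map Fin.valEmbedding, h1, Nat.card_Ico]
    omega
  let X : Fin T → (Fin T → Fin k) → ℝ := fun u a => (if a u = j then (1 : ℝ) else 0) - I.lam j
  have hsum : ∀ a, ∑ u ∈ S, X u a = (arrivalCount a t j : ℝ) - I.lam j * n := by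
    intro a
    simp only [X, Finset.sum_sub_distrib, Finset.sum_const, hcard, nsmul_eq_mul]
    rw [mul_comm (n : ℝ), Finset.sum_boole, hS, Finset.filter_filter, arrivalCount]
  have hind : iIndepFun X (I.arrivalLaw T) :=
    iIndepFun_pi (X := fun _ i => (if i = j then (1 : ℝ) else 0) - I.lam j)
      fun _ => (measurable_of_countable _).aemeasurable
  have hexp : -(ε * n) ^ 2 / (2 * ((∑ u ∈ S, (1 / 4) : NNReal) : ℝ)) = n * (-(2 * ε ^ 2)) := by
    simp only [Finset.sum_const, hcard, nsmul_eq_mul]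
    push_cast
    field_simp
    norm_num
  have hsub : HasSubgaussianMGF (fun a => ∑ u ∈ S, X u a) (∑ u ∈ S, (1 / 4)) (I.arrivalLaw T) :=
    HasSubgaussianMGF.sum_of_iIndepFun hind fun u _ => I.hasSubgaussianMGF_arrival T j u
  have hup := hsub.measure_ge_le (ε := ε * n) (by positivity)
  have hdown := hsub.neg.measure_ge_le (ε := ε * n) (by positivity)
  rw [hexp, Real.exp_nat_mul] at hup hdown
  refine (measureReal_mono ?_).trans ((measureReal_union_le _ _).trans
    ((add_le_add hup hdown).trans_eq (two_mul _).symm))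
  intro a ha
  rw [Set.mem_ofPred_eq, le_abs] at ha
  simpa only [Set.mem_union, Set.mem_ofPred_eq, Pi.neg_apply, hsum] using ha

theorem measureReal_jointLaw_fst {T : ℕ} (s : Set (Fin T → Fin k)) :
    (I.jointLaw T).real {ω | ω.1 ∈ s} = (I.arrivalLaw T).real s := by
  have : {ω : (Fin T → Fin k) × (Fin T → Fin k) | ω.1 ∈ s} = s ×ˢ Set.univ := by ext; simp
  rw [this, jointLaw, measureReal_prod_prod]
  simp

theorem measureReal_jointLaw_snd {T : ℕ} (s : Set (Fin T → Fin k)) :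
    (I.jointLaw T).real {ω | ω.2 ∈ s} = (I.arrivalLaw T).real s := by
  have : {ω : (Fin T → Fin k) × (Fin T → Fin k) | ω.2 ∈ s} = Set.univ ×ˢ s := by ext; simp
  rw [this, jointLaw, measureReal_prod_prod]
  simp

theorem exists_lam_ge : ∃ l : ℝ, 0 < l ∧ ∀ j, l ≤ I.lam j := by
  obtain ⟨j0⟩ := I.exists_type
  obtain ⟨j, -, hj⟩ := Finset.exists_min_image Finset.univ I.lam ⟨j0, Finset.mem_univ _⟩
  exact ⟨I.lam j, I.lam_pos j, fun i => hj i (Finset.mem_univ i)⟩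

/-- If both vectors of future arrivals are close to their means, the decision in period `t - 1` does
not decrease the hybrid objective, up to a bounded number of final periods. -/
theorem exists_hybrid_le_of_concentrated : ∃ (ε : ℝ) (n₀ : ℕ), 0 < ε ∧ ∀ (T B t : ℕ)
    (rule : ℕ → (Fin k → ℕ) → (Fin k → ℕ) → (Fin k → ℕ)) (a a' : Fin T → Fin k),
    I.IsOptimalRule B rule → 2 ≤ t → t ≤ T → n₀ ≤ T + 1 - t →
    (∀ j, |(arrivalCount a t j : ℝ) - I.lam j * (T + 1 - t : ℕ)| < ε * (T + 1 - t : ℕ)) →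
    (∀ j, |(arrivalCount a' t j : ℝ) - I.lam j * (T + 1 - t : ℕ)| < ε * (T + 1 - t : ℕ)) →
    hybrid I B rule a a' (t - 1) ≤ hybrid I B rule a a' t := by
  obtain ⟨C, w₀, h⟩ := I.exists_hybrid_le
  obtain ⟨l, hl, hlam⟩ := I.exists_lam_ge
  obtain ⟨n₀, hn₀⟩ := exists_nat_ge (4 * w₀ / l)
  -- The counts differ in total by at most `d ≤ 2 k ε n`, and the requirement is
  -- `2 C d + 2 w₀ + 3 ε n ≤ l n`, of which `w₀` takes one half and `ε` the other.
  refine ⟨l / (2 * (4 * C * k + 3)), n₀, by positivity, ?_⟩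
  intro T B t rule a a' hrule ht htT hn ha ha'
  obtain ⟨s, rfl⟩ := Nat.exists_eq_add_of_le' ht
  set n := T + 1 - (s + 2) with hndef
  set ε := l / (2 * (4 * C * k + 3)) with hε
  have hε0 : 0 < ε := by positivity
  have hεl : (4 * C * k + 3) * ε = l / 2 := by rw [hε]; field_simp
  have hnw : 4 * w₀ ≤ l * n := by
    have h1 : (n₀ : ℝ) ≤ n := by exact_mod_cast hn
    have h2 := hn₀.trans h1
    rw [div_le_iff₀ hl] at h2
    linarith
  have hn0 : (0 : ℝ) ≤ n := n.cast_nonneg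
  set d := ∑ j, (arrivalCount a (s + 2) j - arrivalCount a' (s + 2) j)
    + ∑ j, (arrivalCount a' (s + 2) j - arrivalCount a (s + 2) j) with hd
  have hdle : (d : ℝ) ≤ k * (2 * ε * n) := by
    rw [hd, ← Finset.sum_add_distrib, Nat.cast_sum]
    refine (Finset.sum_le_card_nsmul _ _ (2 * ε * n) fun j _ => ?_).trans (by simp)
    have h1 := abs_lt.mp (ha j)
    have h2 := abs_lt.mp (ha' j)
    rcases le_total (arrivalCount a (s + 2) j) (arrivalCount a' (s + 2) j) with hc | hc
    · rw [Nat.sub_eq_zero_of_le hc, zero_add, Nat.cast_sub hc]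
      linarith
    · rw [Nat.sub_eq_zero_of_le hc, add_zero, Nat.cast_sub hc]
      linarith
  have hCd : 2 * (C * d + w₀ : ℝ) + 3 * ε * n ≤ l * n := by
    have h1 := mul_le_mul_of_nonneg_left hdle (C.cast_nonneg (α := ℝ))
    have h2 : (4 * C * k + 3) * ε * n = l / 2 * n := by rw [hεl]
    linarith
  have hln : ∀ j, l * n ≤ I.lam j * n := fun j => mul_le_mul_of_nonneg_right (hlam j) hn0
  have hεn : 0 ≤ ε * n := by positivity
  refine h T B s d rule a a' hrule (by omega) (Nat.le_add_right _ _) (Nat.le_add_left _ _)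
    (fun i => ?_) (fun i => ?_)
  · have h2 := abs_lt.mp (ha' i)
    have h3 := hln i
    have : (2 * (C * d + w₀) : ℝ) ≤ arrivalCount a' (s + 2) i := by linarith
    exact_mod_cast this
  · have h1 := abs_lt.mp (ha i)
    have h2 := abs_lt.mp (ha' i)
    have h3 := hln i
    have : (2 * (C * d + w₀) + arrivalCount a' (s + 2) i : ℝ) ≤ 2 * arrivalCount a (s + 2) i := by
      linarith
    exact_mod_cast this

end CustomerTypes

theorem lemma3 {k : ℕ} (I : CustomerTypes k) :
    ∃ M₂ : ℝ, ∀ (T B : ℕ) (rule : ℕ → (Fin k → ℕ) → (Fin k → ℕ) → (Fin k → ℕ)),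
      I.IsOptimalRule B rule →
        ∑ t ∈ Finset.Icc 2 T,
          (I.jointLaw T).real
            {ω | hybrid I B rule ω.1 ω.2 (t - 1) - hybrid I B rule ω.1 ω.2 t > 0} ≤ M₂ := by
  obtain ⟨ε, n₀, hε, hconc⟩ := I.exists_hybrid_le_of_concentrated
  set q := Real.exp (-(2 * ε ^ 2)) with hq
  have hq0 : 0 < q := Real.exp_pos _
  have hq1 : q < 1 := Real.exp_lt_one_iff.mpr (by nlinarith [sq_pos_of_pos hε])
  refine ⟨(4 * k + (q ^ n₀)⁻¹) * (1 - q)⁻¹, fun T B rule hrule => ?_⟩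
  have hterm : ∀ t ∈ Finset.Icc 2 T, (I.jointLaw T).real
      {ω | hybrid I B rule ω.1 ω.2 (t - 1) - hybrid I B rule ω.1 ω.2 t > 0}
        ≤ (4 * k + (q ^ n₀)⁻¹) * q ^ (T + 1 - t) := by
    intro t ht
    obtain ⟨ht2, htT⟩ := Finset.mem_Icc.mp ht
    rcases lt_or_ge (T + 1 - t) n₀ with hn | hn
    · -- The term `(q ^ n₀)⁻¹` of the constant pays for the last periods, where counts do not help.
      have h1 : (1 : ℝ) ≤ (q ^ n₀)⁻¹ * q ^ (T + 1 - t) := by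
        rw [inv_mul_eq_div, one_le_div (by positivity)]
        exact pow_le_pow_of_le_one hq0.le hq1.le hn.le
      have h2 : 0 ≤ 4 * k * q ^ (T + 1 - t) := by positivity
      refine measureReal_le_one.trans ?_
      linarith
    · let D : Fin k → Set (Fin T → Fin k) := fun j => {a | ε * (T + 1 - t : ℕ) ≤
        |(arrivalCount a t j : ℝ) - I.lam j * (T + 1 - t : ℕ)|}
      have hD : ∀ j, (I.arrivalLaw T).real (D j) ≤ 2 * q ^ (T + 1 - t) := fun j =>
        I.measureReal_arrivalCount_deviation_le (by omega) htT j hε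
      have hsub : {ω : (Fin T → Fin k) × (Fin T → Fin k) |
          hybrid I B rule ω.1 ω.2 (t - 1) - hybrid I B rule ω.1 ω.2 t > 0}
            ⊆ ⋃ j, ({ω | ω.1 ∈ D j} ∪ {ω | ω.2 ∈ D j}) := by
        intro ω hω
        by_contra hno
        simp only [Set.mem_iUnion, Set.mem_union, Set.mem_ofPred_eq, not_exists, not_or, D,
          not_le] at hno
        have := hconc T B t rule ω.1 ω.2 hrule ht2 htT hn (fun j => (hno j).1) fun j => (hno j).2
        rw [Set.mem_ofPred_eq] at hω
        linarith
      have h1 : (I.jointLaw T).real (⋃ j, ({ω | ω.1 ∈ D j} ∪ {ω | ω.2 ∈ D j}))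
          ≤ ∑ _j : Fin k, 4 * q ^ (T + 1 - t) := by
        refine (measureReal_iUnion_fintype_le _).trans (Finset.sum_le_sum fun j _ => ?_)
        refine (measureReal_union_le _ _).trans ?_
        rw [I.measureReal_jointLaw_fst, I.measureReal_jointLaw_snd]
        linarith [hD j]
      have h2 : 0 ≤ (q ^ n₀)⁻¹ * q ^ (T + 1 - t) := by positivity
      refine (measureReal_mono hsub).trans (h1.trans ?_)
      simp only [Finset.sum_const, Finset.card_univ, Fintype.card_fin, nsmul_eq_mul]
      linarith
  refine (Finset.sum_le_sum hterm).trans ?_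
  rw [← Finset.mul_sum]
  refine mul_le_mul_of_nonneg_left ?_ (by positivity)
  calc ∑ t ∈ Finset.Icc 2 T, q ^ (T + 1 - t)
      ≤ ∑ t ∈ Finset.range (T + 2), q ^ (T + 2 - 1 - t) := by
        refine Finset.sum_le_sum_of_subset_of_nonneg (fun t ht => ?_) fun _ _ _ => by positivity
        simp only [Finset.mem_Icc, Finset.mem_range] at ht ⊢
        omega
    _ = ∑ n ∈ Finset.range (T + 2), q ^ n := Finset.sum_range_reflect (fun n => q ^ n) (T + 2)
    _ ≤ (1 - q)⁻¹ := by
        rw [← tsum_geometric_of_lt_one hq0.le hq1]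
        exact (summable_geometric_of_lt_one hq0.le hq1).sum_le_tsum _ fun _ _ => by positivity
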